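/- **Setting.** Let $B\ge 1$, $b\ge 1$ be integers and let $h_1,\dots,h_b : U\to\{1,\dots,B\}$ be independent, perfectly random hash functions on a universe $U$, i.e. the values $h_i(x)$ ($1\le i\le b$, $x\in U$) are independent and uniform on $\{1,\dots,B\}$. The Bloom filter of a finite set $X\subseteq U$ is the bit vector of length $B$ whose $j$-th bit is $1$ iff $h_i(x)=j$ for some $i$ and some $x\in X$; let $B_{X,1}$ be its number of ones. The Swamidass estimator of $|X|$ is $$\widehat{|X|}_S=-\frac{B}{b}\log\Bigl(1-\frac{B_{X,1}}{B}\Bigr)\quad\text{if } B_{X,1}<B,$$ and, since the formula is infinite for a saturated filter, $\widehat{|X|}_S=s$ if $B_{X,1}=B$, where $s$ is any fixed number with $0\le s\le \frac{B}{b}\log B$ (the choice $s=\frac Bb\log B$ amounts to replacing $B_{X,1}=B$ by $B-1$). For finite sets $X,Y\subseteq U$, the estimator $\widehat{|X\cap Y|}_{AND}$ of $|X\cap Y|$ is the same expression computed from the Bloom filter of $X\cap Y$, i.e. with $B_{X\cap Y,1}$ in place of $B_{X,1}$. Write $$R(B,b,n)=e^{nb/(B-1)}\,\frac{B}{b^2}-\frac{B}{b^2}-\frac{n}{b}.$$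 **Proposition.** Let $B\to\infty$ and let $b\ge 1$ satisfy $b=o(\sqrt B)$. Then there is a quantity $\varepsilon=o(1)$, depending only on the parameters $(B,b)$ and not on the universe, the sets, $s$ or $t$, such that for all sufficiently large $B$ the following holds. 1. For all finite sets $X,Y$ with $b\,|X\cap Y|\le 0.499\,B\log B$, the squared error of $\widehat{|X\cap Y|}_{AND}$ has finite expectation, $$E\Bigl[\bigl(\widehat{|X\cap Y|}_{AND}-|X\cap Y|\bigr)^2\Bigr]\le(1+\varepsilon)\,R(B,b,|X\cap Y|),$$ and for every $t>0$ $$P\Bigl(\bigl|\widehat{|X\cap Y|}_{AND}-|X\cap Y|\bigr|\ge t\Bigr)\le(1+\varepsilon)\,\frac{R(B,b,|X\cap Y|)}{t^2}.$$ 2. For every finite set $X$ with $b\,|X|\le 0.499\,B\log B$, the squared error of $\widehat{|X|}_S$ has finite expectation, $$E\Bigl[\bigl(\widehat{|X|}_S-|X|\bigr)^2\Bigr]\le(1+\varepsilon)\,R(B,b,|X|),$$ and for every $t>0$ $$P\Bigl(\bigl|\widehat{|X|}_S-|X|\bigr|\ge t\Bigr)\le(1+\varepsilon)\,\frac{R(B,b,|X|)}{t^2}.$$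 -/

import Mathlib

namespace BloomFilter

open MeasureTheory ProbabilityTheory

/-- The bit vector, of length `B`, of the Bloom filter of the finite set `X` built with the `b` hash
functions `h 0, …, h (b - 1)`: bit `j` is set iff some hash function sends some element of `X`
to `j`. -/
noncomputable def bits {U : Type*} {B b : ℕ} (h : Fin b → U → Fin B) (X : Finset U) :
    Fin B → Bool :=
  open Classical in fun j => decide (∃ i : Fin b, ∃ x ∈ X, h i x = j)

/-- The number of ones in a bit vector. -/
def ones {B : ℕ} (v : Fin B → Bool) : ℕ :=
  (Finset.univ.filter fun j => v j = true).card

/-- The Swamidass estimator `-(B / b) * log (1 - B₁ / B)` as a function of the number `B₁` of ones.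
The formula gives no finite number for a saturated filter, `B₁ = B`; there the value is `s`. -/
noncomputable def swamidass (B b : ℕ) (s : ℝ) (B₁ : ℕ) : ℝ :=
  if B₁ = B then s else -((B : ℝ) / b) * Real.log (1 - (B₁ : ℝ) / B)

/-- The estimator of `|X|`, computed from the Bloom filter of `X`. -/
noncomputable def estimator {U : Type*} {B b : ℕ} (s : ℝ) (h : Fin b → U → Fin B)
    (X : Finset U) : ℝ :=
  swamidass B b s (ones (bits h X))

/-- The estimator of `|X ∩ Y|`, computed from the Bloom filter of `X ∩ Y`. -/
noncomputable def estimatorAND {U : Type*} [DecidableEq U] {B b : ℕ} (s : ℝ)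
    (h : Fin b → U → Fin B) (X Y : Finset U) : ℝ :=
  swamidass B b s (ones (bits h (X ∩ Y)))

/-- `h 0, …, h (b - 1)` are independent, perfectly random hash functions into `B` positions: the
values `h i x`, over all `i` and `x`, are independent and uniformly distributed. -/
structure IsPerfectlyRandom {Ω : Type*} [MeasurableSpace Ω] (μ : Measure Ω) {U : Type*} {B b : ℕ}
    (h : Ω → Fin b → U → Fin B) : Prop where
  measurable : ∀ i x, Measurable fun ω => h ω i x
  uniform : ∀ i x j, μ.real {ω | h ω i x = j} = 1 / (B : ℝ)
  indep : iIndepFun (fun (p : Fin b × U) ω => h ω p.1 p.2) μ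

/-- The leading term `e^{n b / (B - 1)} B / b² - B / b² - n / b` of the bound, for a set of size
`n`. -/
noncomputable def mseBound (B b n : ℕ) : ℝ :=
  Real.exp ((n : ℝ) * b / ((B : ℝ) - 1)) * ((B : ℝ) / (b : ℝ) ^ 2) - (B : ℝ) / (b : ℝ) ^ 2
    - (n : ℝ) / b

end BloomFilter

namespace BloomFilter

open MeasureTheory ProbabilityTheory

/-! The filter of a set of size `n` is the outcome of throwing `N = b * n` independent balls into
`B` bins. If `Z` bins stay empty and `L Z` is `log (Z / B)`, the error of the estimator is `-(B / b)
* (L Z + N / B)`, so a mean square bound for `L Z + N / B` suffices; Markov's inequality then gives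
the tail bound. `Z` is a Markov chain (`integral_comp_emptyCount`). The functions `z` and `z * (z -
1)` are eigenfunctions of its operator, which gives the mean `B * p`, `p = (1 - 1 / B) ^ N`, and the
variance; its generating function is at most the binomial one (`step_iterate_pow_le`), which gives a
Chernoff bound. Now `L Z + N / B = log (Z / (B * p)) + (log p + N / B)`. Unless `Z` falls well below
its mean, the first summand is nearly linear in `Z`, and its mean square is governed by
`relative_variance_le`. The second is a small deterministic bias. The remaining event is
exponentially rare. `sq_error_le` combines the three, and each is measured against `leading`. -/

/-- The number of empty bins after the balls `P` have been thrown according to `g`. -/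
def emptyCount {α : Type*} {B : ℕ} (g : α → Fin B) (P : Finset α) : ℕ :=
  ((P.image g)ᶜ).card

/-- The one-ball transition operator of the number of empty bins among `B`. -/
noncomputable def step (B : ℕ) (f : ℕ → ℝ) (z : ℕ) : ℝ :=
  (z : ℝ) / B * f (z - 1) + (1 - (z : ℝ) / B) * f z

/-! ### The law of the number of empty bins -/

lemma emptyCount_le {α : Type*} {B : ℕ} (g : α → Fin B) (P : Finset α) :
    emptyCount g P ≤ B := by
  simpa [emptyCount] using Finset.card_le_univ ((P.image g)ᶜ)

lemma ones_bits {U : Type*} {B b : ℕ} (h : Fin b → U → Fin B) (X : Finset U) :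
    ones (bits h X) = B - emptyCount (fun p : Fin b × U => h p.1 p.2) (Finset.univ ×ˢ X) := by
  classical
  have h1 : (Finset.univ.filter fun j => bits h X j = true)
      = (Finset.univ ×ˢ X).image (fun p : Fin b × U => h p.1 p.2) := by
    ext j
    simp only [bits, decide_eq_true_eq, Finset.mem_filter, Finset.mem_univ, true_and,
      Finset.mem_image, Finset.mem_product, Prod.exists]
  have h2 : ((Finset.univ ×ˢ X).image (fun p : Fin b × U => h p.1 p.2)).card ≤ B := by
    simpa using Finset.card_le_univ ((Finset.univ ×ˢ X).image (fun p : Fin b × U => h p.1 p.2))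
  rw [ones, h1, emptyCount, Finset.card_compl, Fintype.card_fin]
  omega

lemma image_eq_attach_image {Ω α : Type*} {B : ℕ} (g : α → Ω → Fin B) (P : Finset α) (ω : Ω) :
    (P.image fun a => g a ω) = P.attach.image fun a : P => g a ω := by
  ext j; simp

lemma measurable_comp_image {Ω α : Type*} [MeasurableSpace Ω] {B : ℕ}
    {g : α → Ω → Fin B} (hg : ∀ a, Measurable (g a)) (P : Finset α) (F : Finset (Fin B) → ℝ) :
    Measurable fun ω => F (P.image fun a => g a ω) := by
  have h1 : Measurable fun (ω : Ω) (a : P) => g a ω := measurable_pi_lambda _ fun a => hg a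
  have h2 : (fun ω => F (P.image fun a => g a ω))
      = (fun v : P → Fin B => F (P.attach.image v)) ∘ fun (ω : Ω) (a : P) => g a ω :=
    funext fun ω => congrArg F (image_eq_attach_image g P ω)
  rw [h2]
  exact Measurable.of_discrete.comp h1

lemma integrable_comp_emptyCount {Ω α : Type*} [MeasurableSpace Ω] {μ : Measure Ω}
    [IsFiniteMeasure μ] {B : ℕ} {g : α → Ω → Fin B} (hg : ∀ a, Measurable (g a))
    (P : Finset α) (f : ℕ → ℝ) :
    Integrable (fun ω => f (emptyCount (fun a => g a ω) P)) μ := by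
  have hm : Measurable fun ω => f (emptyCount (fun a => g a ω) P) :=
    measurable_comp_image hg P fun s => f (sᶜ).card
  refine Integrable.of_bound hm.aestronglyMeasurable
    (∑ z ∈ Finset.range (B + 1), ‖f z‖) (Filter.Eventually.of_forall fun ω => ?_)
  exact Finset.single_le_sum (f := fun z => ‖f z‖) (fun _ _ => norm_nonneg _)
    (Finset.mem_range.2 (Nat.lt_succ_of_le (emptyCount_le _ P)))

lemma sum_card_erase {B : ℕ} (hB : 0 < B) (E : Finset (Fin B)) (f : ℕ → ℝ) :
    ∑ j, 1 / (B : ℝ) * f (E.erase j).card = step B f E.card := by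
  classical
  rw [← Finset.sum_add_sum_compl E]
  have h1 : ∑ j ∈ E, 1 / (B : ℝ) * f (E.erase j).card
      = ∑ j ∈ E, 1 / (B : ℝ) * f (E.card - 1) :=
    Finset.sum_congr rfl fun j hj => by rw [Finset.card_erase_of_mem hj]
  have h2 : ∑ j ∈ Eᶜ, 1 / (B : ℝ) * f (E.erase j).card
      = ∑ j ∈ Eᶜ, 1 / (B : ℝ) * f E.card :=
    Finset.sum_congr rfl fun j hj => by
      rw [Finset.erase_eq_of_notMem (Finset.mem_compl.1 hj)]
  have h3 : (Eᶜ.card : ℝ) = B - E.card := by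
    rw [Finset.card_compl, Fintype.card_fin, Nat.cast_sub (by simpa using Finset.card_le_univ E)]
  have hB' : (B : ℝ) ≠ 0 := by positivity
  rw [h1, h2, Finset.sum_const, Finset.sum_const, nsmul_eq_mul, nsmul_eq_mul, h3, step]
  field_simp

/-- The number of empty bins evolves as the Markov chain with transition operator `step B`. -/
theorem integral_comp_emptyCount {Ω α : Type*} [MeasurableSpace Ω] {μ : Measure Ω}
    [IsProbabilityMeasure μ] {B : ℕ} (hB : 0 < B) {g : α → Ω → Fin B}
    (hg : ∀ a, Measurable (g a)) (hu : ∀ a j, μ.real {ω | g a ω = j} = 1 / (B : ℝ))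
    (hi : iIndepFun g μ) (P : Finset α) (f : ℕ → ℝ) :
    ∫ ω, f (emptyCount (fun a => g a ω) P) ∂μ = (step B)^[P.card] f B := by
  classical
  induction P using Finset.induction_on generalizing f with
  | empty => simp [emptyCount]
  | insert q P hq ih =>
    rw [Finset.card_insert_of_notMem hq, Function.iterate_succ_apply, ← ih]
    let E : Ω → Finset (Fin B) := fun ω => (P.image fun a => g a ω)ᶜ
    have hE : ∀ ω, f (emptyCount (fun a => g a ω) (insert q P))
        = ∑ j, Set.indicator {ω | g q ω = j} (fun _ => (1 : ℝ)) ω * f ((E ω).erase j).card := by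
      intro ω
      rw [Finset.sum_eq_single (g q ω)]
      · have : ((insert q P).image fun a => g a ω)ᶜ = (E ω).erase (g q ω) := by
          ext j; simp [E]
        rw [emptyCount, this]; simp
      · intro j _ hj
        rw [Set.indicator_of_notMem (by simpa using hj.symm), zero_mul]
      · simp
    have hmE : ∀ j, Measurable fun ω => f ((E ω).erase j).card := fun j =>
      measurable_comp_image hg P fun s => f (sᶜ.erase j).card
    have hbd : ∀ j, Integrable (fun ω => f ((E ω).erase j).card) μ := fun j => by
      refine Integrable.of_bound (hmE j).aestronglyMeasurable
        (∑ z ∈ Finset.range (B + 1), ‖f z‖) (Filter.Eventually.of_forall fun ω => ?_)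
      refine Finset.single_le_sum (f := fun z => ‖f z‖) (fun _ _ => norm_nonneg _)
        (Finset.mem_range.2 (Nat.lt_succ_of_le ?_))
      simpa using Finset.card_le_univ ((E ω).erase j)
    have hms : ∀ j, MeasurableSet {ω | g q ω = j} := fun j => hg q (measurableSet_singleton j)
    have hind : ∀ j, IndepFun (Set.indicator {ω | g q ω = j} (fun _ => (1 : ℝ)))
        (fun ω => f ((E ω).erase j).card) μ := by
      intro j
      have h0 := hi.indepFun_finset {q} P (by simpa using hq) hg
      have h1 := h0.comp (φ := fun v => if v ⟨q, by simp⟩ = j then (1 : ℝ) else 0)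
        (ψ := fun v => f (((P.attach.image v)ᶜ).erase j).card)
        Measurable.of_discrete Measurable.of_discrete
      convert h1 using 1
      · ext ω; simp [Set.indicator_apply]
      · exact funext fun ω => congrArg (fun s : Finset (Fin B) => f (sᶜ.erase j).card)
          (image_eq_attach_image g P ω)
    -- Condition on the bin `j` of the new ball, which is independent of the bins hit by `P`.
    simp_rw [hE]
    rw [integral_finsetSum]
    · have : ∀ ω, step B f (emptyCount (fun a => g a ω) P)
          = ∑ j, 1 / (B : ℝ) * f ((E ω).erase j).card := fun ω =>
        (sum_card_erase hB (E ω) f).symm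
      simp_rw [this]
      rw [integral_finsetSum _ fun j _ => (hbd j).const_mul _]
      refine Finset.sum_congr rfl fun j _ => ?_
      have h2 := (hind j).integral_fun_mul_eq_mul_integral
        ((measurable_const.indicator (hms j)).aestronglyMeasurable) (hmE j).aestronglyMeasurable
      rw [h2, integral_indicator_const _ (hms j), hu, integral_const_mul, smul_eq_mul, mul_one]
    · intro j _
      have := (hbd j).indicator (hms j)
      refine this.congr (Filter.Eventually.of_forall fun ω => ?_)
      by_cases hω : g q ω = j <;> simp [hω]

/-! ### Moments and generating function of the chain -/

lemma step_const_mul (B : ℕ) (c : ℝ) (f : ℕ → ℝ) :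
    step B (fun z => c * f z) = fun z => c * step B f z := by
  ext z; simp only [step]; ring

lemma step_iterate_of_eigen {B : ℕ} {c : ℝ} {f : ℕ → ℝ}
    (h : ∀ z, step B f z = c * f z) (N : ℕ) :
    (step B)^[N] f = fun z => c ^ N * f z := by
  induction N with
  | zero => simp
  | succ N ih =>
    rw [Function.iterate_succ_apply', ih, step_const_mul]
    ext z; rw [h]; ring

lemma step_iterate_natCast {B : ℕ} (N : ℕ) :
    (step B)^[N] (fun z => (z : ℝ)) = fun z : ℕ => (1 - 1 / (B : ℝ)) ^ N * (z : ℝ) := by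
  refine step_iterate_of_eigen (fun z => ?_) N
  -- At `z = 0` the truncated `z - 1` is harmless: its coefficient `z / B` vanishes.
  rcases z with _ | z
  · simp [step]
  · simp only [step]; push_cast [Nat.add_sub_cancel]; ring

lemma step_iterate_mul_pred {B : ℕ} (N : ℕ) :
    (step B)^[N] (fun z => (z : ℝ) * (z - 1))
      = fun z : ℕ => (1 - 2 / (B : ℝ)) ^ N * ((z : ℝ) * (z - 1)) := by
  refine step_iterate_of_eigen (fun z => ?_) N
  rcases z with _ | z
  · simp [step]
  · simp only [step]; push_cast [Nat.add_sub_cancel]; ring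

/-- The left side is `y ^ z * (1 + z * a)` with `a = (1 / y - 1) / B`; Bernoulli's inequality bounds
it by `(y * (1 + a)) ^ z`. -/
lemma step_pow_le {B : ℕ} (hB : 0 < B) {y : ℝ} (hy : 0 < y) (hy1 : y ≤ 1) (z : ℕ) :
    step B (fun z => y ^ z) z ≤ (1 - (1 - 1 / (B : ℝ)) * (1 - y)) ^ z := by
  rcases z with _ | z
  · simp [step]
  · have hB' : (0 : ℝ) < B := by positivity
    have ha : (0 : ℝ) ≤ (1 / (B : ℝ)) * (1 / y - 1) :=
      mul_nonneg (by positivity) (sub_nonneg.2 (by rw [le_div_iff₀ hy]; simpa using hy1))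
    have h1 := one_add_mul_le_pow (a := (1 / (B : ℝ)) * (1 / y - 1)) (by linarith) (z + 1)
    have h2 := mul_le_mul_of_nonneg_left h1 (pow_pos hy (z + 1)).le
    rw [← mul_pow] at h2
    have e1 : y * (1 + 1 / (B : ℝ) * (1 / y - 1)) = 1 - (1 - 1 / (B : ℝ)) * (1 - y) := by
      field_simp; ring
    rw [e1] at h2
    refine le_trans (le_of_eq ?_) h2
    simp only [step, Nat.add_sub_cancel]
    field_simp
    ring

/-- The generating function of the number of empty bins is dominated by that of independent bins. -/
lemma step_iterate_pow_le {B : ℕ} (hB : 0 < B) {x : ℝ} (hx : 0 < x) (hx1 : x ≤ 1) (N : ℕ) :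
    ∀ z ≤ B, (step B)^[N] (fun z => x ^ z) z ≤ (1 - (1 - 1 / (B : ℝ)) ^ N * (1 - x)) ^ z := by
  induction N with
  | zero => intro z _; simp
  | succ N ih =>
    intro z hz
    rw [Function.iterate_succ_apply']
    have hB' : (0 : ℝ) < B := by positivity
    have hz' : (z : ℝ) / B ≤ 1 := (div_le_one hB').2 (by exact_mod_cast hz)
    have hB1 : (1 : ℝ) / B ≤ 1 := (div_le_one hB').2 (by exact_mod_cast hB)
    have hr0 : (0 : ℝ) ≤ 1 - 1 / B := by linarith
    have hr1 : (1 : ℝ) - 1 / B ≤ 1 := by linarith [show (0 : ℝ) ≤ 1 / B by positivity]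
    have hp0 := pow_nonneg hr0 N
    have hp1 := pow_le_one₀ (n := N) hr0 hr1
    set p := (1 - 1 / (B : ℝ)) ^ N with hp
    -- `step` is monotone here because `z ≤ B` makes both of its weights nonnegative.
    have hstep : step B ((step B)^[N] fun z => x ^ z) z
        ≤ step B (fun z => (1 - p * (1 - x)) ^ z) z :=
      add_le_add (mul_le_mul_of_nonneg_left (ih _ (by omega)) (by positivity))
        (mul_le_mul_of_nonneg_left (ih _ hz) (by linarith))
    refine hstep.trans ((step_pow_le hB (by nlinarith) (by nlinarith) z).trans (le_of_eq ?_))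
    rw [pow_succ, ← hp]; ring

/-! ### Variance, bias and tail estimates -/

/-- The leading term of the mean squared relative error when `N` balls fall into `B` bins. -/
noncomputable def leading (B N : ℕ) : ℝ :=
  1 / (B : ℝ) * (Real.exp ((N : ℝ) / ((B : ℝ) - 1)) - 1 - (N : ℝ) / B)

/-- The relative error of the bound, as a function of `y = B ^ (1 / 8)`. -/
noncomputable def errorRate (y : ℝ) : ℝ :=
  (1 + (y ^ 4)⁻¹) / (1 - y⁻¹) ^ 2 * (1 + 2 * (y ^ 8)⁻¹) + (1 + y ^ 4) * (4 * (y ^ 8)⁻¹)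
    + 2 * y ^ 40 * Real.exp (-(y ^ 2 / 2)) - 1

/-- `(1 + t + t ^ 2 / 2) * (1 - t + t ^ 2 / 2) = 1 + t ^ 4 / 4 ≥ 1`. -/
lemma exp_neg_le_quadratic {t : ℝ} (ht : 0 ≤ t) : Real.exp (-t) ≤ 1 - t + t ^ 2 / 2 := by
  have h1 := Real.quadratic_le_exp_of_nonneg ht
  have h2 : 0 < 1 - t + t ^ 2 / 2 := by nlinarith [sq_nonneg (t - 1)]
  rw [Real.exp_neg, inv_le_comm₀ (Real.exp_pos t) h2]
  refine le_trans ?_ h1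
  rw [inv_le_iff_one_le_mul₀ h2]
  nlinarith [sq_nonneg (t ^ 2)]

/-- The yardstick by which lower-order terms are absorbed into the relative error. -/
lemma sq_div_le_leading {B : ℕ} (hB : 2 ≤ B) (N : ℕ) :
    ((N : ℝ) / B) ^ 2 / (2 * B) ≤ leading B N := by
  have hB' : (2 : ℝ) ≤ B := by exact_mod_cast hB
  have h1 : (N : ℝ) / B ≤ N / ((B : ℝ) - 1) :=
    div_le_div_of_nonneg_left (by positivity) (by linarith) (by linarith)
  have h2 := Real.quadratic_le_exp_of_nonneg (x := (N : ℝ) / B) (by positivity)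
  have h3 := h2.trans (Real.exp_le_exp.2 h1)
  have h4 : ((N : ℝ) / B) ^ 2 / (2 * B) = 1 / (B : ℝ) * (((N : ℝ) / B) ^ 2 / 2) := by
    field_simp
  rw [h4, leading]
  exact mul_le_mul_of_nonneg_left (by linarith) (by positivity)

lemma inv_pow_le_exp {B : ℕ} (hB : 2 ≤ B) (N : ℕ) :
    ((1 - 1 / (B : ℝ)) ^ N)⁻¹ ≤ Real.exp ((N : ℝ) / ((B : ℝ) - 1)) := by
  have hB' : (2 : ℝ) ≤ B := by exact_mod_cast hB
  have h0 : (B : ℝ) - 1 ≠ 0 := by linarith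
  have h1 : (1 - 1 / (B : ℝ))⁻¹ = 1 / ((B : ℝ) - 1) + 1 := by
    rw [one_sub_div (by linarith)]
    field_simp
    ring
  have h2 : (0 : ℝ) ≤ 1 / ((B : ℝ) - 1) + 1 :=
    add_nonneg (one_div_nonneg.2 (by linarith)) zero_le_one
  rw [← inv_pow, h1, div_eq_mul_one_div (N : ℝ), Real.exp_nat_mul]
  exact pow_le_pow_left₀ h2 (Real.add_one_le_exp _) N

lemma pow_pos_of_two_le {B : ℕ} (hB : 2 ≤ B) (N : ℕ) : 0 < (1 - 1 / (B : ℝ)) ^ N := by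
  have hB' : (2 : ℝ) ≤ B := by exact_mod_cast hB
  refine pow_pos (sub_pos.2 ?_) N
  rw [div_lt_one (by linarith)]; linarith

/-- The relative variance of the number of empty bins. -/
lemma relative_variance_le {B : ℕ} (hB : 10 ≤ B) (N : ℕ) :
    (1 - 2 / (B : ℝ)) ^ N * (B * (B - 1)) / (B * (1 - 1 / (B : ℝ)) ^ N) ^ 2
      + 1 / (B * (1 - 1 / (B : ℝ)) ^ N) - 1 ≤ (1 + 2 / (B : ℝ)) * leading B N := by
  have hB' : (10 : ℝ) ≤ B := by exact_mod_cast hB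
  have hp := pow_pos_of_two_le (by omega : 2 ≤ B) N
  have hinv := inv_pow_le_exp (by omega : 2 ≤ B) N
  have hlow := sq_div_le_leading (by omega : 2 ≤ B) N
  have hB1 : (B : ℝ) - 1 ≠ 0 := by linarith
  set u : ℝ := 1 / ((B : ℝ) - 1) ^ 2 with hu
  have hu0 : 0 ≤ u := by positivity
  -- This factorization cancels the squared mean; `1 - u` carries the negative correlation of the
  -- bins.
  have hratio : (1 - 2 / (B : ℝ)) = (1 - u) * (1 - 1 / (B : ℝ)) ^ 2 := by
    rw [hu]; field_simp; ring
  have hq : (1 - 2 / (B : ℝ)) ^ N = (1 - u) ^ N * ((1 - 1 / (B : ℝ)) ^ N) ^ 2 := by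
    rw [hratio, mul_pow, ← pow_mul, ← pow_mul, mul_comm 2 N]
  have hu1 : u ≤ 1 := by
    rw [hu, div_le_one (by nlinarith)]; nlinarith
  have hpow : (1 - u) ^ N ≤ 1 - N * u + (N * u) ^ 2 / 2 := by
    refine le_trans ?_ (exp_neg_le_quadratic (t := N * u) (by positivity))
    rw [← mul_neg, Real.exp_nat_mul]
    exact pow_le_pow_left₀ (by linarith) (by linarith [Real.add_one_le_exp (-u)]) N
  set p := (1 - 1 / (B : ℝ)) ^ N with hpdef
  have e1 : (1 - 2 / (B : ℝ)) ^ N * (B * (B - 1)) / (B * p) ^ 2 = (1 - u) ^ N * (1 - 1 / B) := by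
    rw [hq]; field_simp
  have e2 : 1 / (B * p) = 1 / B * p⁻¹ := by field_simp
  have h1B : (0 : ℝ) ≤ 1 - 1 / B := by
    rw [sub_nonneg, div_le_one (by linarith)]; linarith
  have h1B' : (1 : ℝ) - 1 / B ≤ 1 := by linarith [show (0 : ℝ) ≤ 1 / B by positivity]
  have a1 : (1 - u) ^ N * (1 - 1 / (B : ℝ)) ≤ (1 - N * u + (N * u) ^ 2 / 2) * (1 - 1 / B) :=
    mul_le_mul_of_nonneg_right hpow h1B
  have a2 : 1 / (B : ℝ) * p⁻¹ ≤ 1 / B * Real.exp ((N : ℝ) / ((B : ℝ) - 1)) :=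
    mul_le_mul_of_nonneg_left hinv (by positivity)
  have a3 : (N * u) ^ 2 / 2 * (1 - 1 / (B : ℝ)) ≤ (N * u) ^ 2 / 2 :=
    mul_le_of_le_one_right (by positivity) h1B'
  -- The first-order term in `u` supplies the `-N / B` inside `leading`.
  have a4 : 1 / (B : ℝ) * (N / B) ≤ N * u * (1 - 1 / B) := by
    have : N * u * (1 - 1 / (B : ℝ)) = 1 / B * (N / (B - 1)) := by
      rw [hu]; field_simp
    rw [this]
    exact mul_le_mul_of_nonneg_left
      (div_le_div_of_nonneg_left (by positivity) (by linarith) (by linarith)) (by positivity)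
  have a5 : (N * u) ^ 2 / 2 ≤ 2 / B * (((N : ℝ) / B) ^ 2 / (2 * B)) := by
    have hu2 : u ^ 2 ≤ 2 / (B : ℝ) ^ 4 := by
      have hs : (B : ℝ) ^ 2 ≤ 5 / 4 * (B - 1) ^ 2 := by nlinarith
      have hs2 : ((B : ℝ) ^ 2) ^ 2 ≤ (5 / 4 * (B - 1) ^ 2) ^ 2 :=
        pow_le_pow_left₀ (by positivity) hs 2
      have h4 : (0 : ℝ) < (B - 1) ^ 4 := by
        have : (0 : ℝ) < B - 1 := by linarith
        positivity
      have e4 : (5 / 4 * ((B : ℝ) - 1) ^ 2) ^ 2 = 25 / 16 * (B - 1) ^ 4 := by ring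
      have e5 : ((B : ℝ) ^ 2) ^ 2 = B ^ 4 := by ring
      have e6 : u ^ 2 = 1 / ((B : ℝ) - 1) ^ 4 := by
        rw [hu, div_pow, one_pow, ← pow_mul]
      rw [e4, e5] at hs2
      rw [e6, div_le_div_iff₀ h4 (by positivity)]
      linarith
    have : 2 / (B : ℝ) * (((N : ℝ) / B) ^ 2 / (2 * B)) = N ^ 2 * (2 / (B : ℝ) ^ 4) / 2 := by
      field_simp
    rw [this, mul_pow]
    have := mul_le_mul_of_nonneg_left hu2 (sq_nonneg (N : ℝ))
    linarith
  have a6 : 2 / (B : ℝ) * (((N : ℝ) / B) ^ 2 / (2 * B)) ≤ 2 / B * leading B N :=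
    mul_le_mul_of_nonneg_left hlow (by positivity)
  rw [e1, e2]
  have a7 : leading B N = 1 / B * Real.exp ((N : ℝ) / ((B : ℝ) - 1)) - 1 / B - 1 / B * (N / B) := by
    rw [leading]; ring
  have a8 : (1 - N * u + (N * u) ^ 2 / 2) * (1 - 1 / (B : ℝ))
      = 1 - 1 / B - N * u * (1 - 1 / B) + (N * u) ^ 2 / 2 * (1 - 1 / B) := by ring
  rw [a8] at a1
  rw [add_mul, one_mul]
  linarith

/-- Each factor of the power contributes `-1 / B` to the logarithm, up to `5 / 4 / B ^ 2`. -/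
lemma sq_log_pow_add_le {B : ℕ} (hB : 10 ≤ B) (N : ℕ) :
    (Real.log ((1 - 1 / (B : ℝ)) ^ N) + N / B) ^ 2 ≤ 4 / B * leading B N := by
  have hB' : (10 : ℝ) ≤ B := by exact_mod_cast hB
  have hlow := sq_div_le_leading (by omega : 2 ≤ B) N
  have hr : 0 < 1 - 1 / (B : ℝ) := by simpa using pow_pos_of_two_le (by omega : 2 ≤ B) 1
  have h1 := Real.log_le_sub_one_of_pos hr
  have h2 := Real.one_sub_inv_le_log_of_pos hr
  have h3 : 1 - (1 - 1 / (B : ℝ))⁻¹ = -(1 / (B - 1)) := by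
    have : (B : ℝ) - 1 ≠ 0 := by linarith
    rw [one_sub_div (by linarith)]
    field_simp
    ring
  rw [h3] at h2
  have hd : 1 / ((B : ℝ) - 1) ≤ 1 / B + 5 / 4 / B ^ 2 := by
    rw [div_add_div _ _ (by positivity) (by positivity), div_le_div_iff₀ (by linarith)
      (by positivity)]
    nlinarith [mul_nonneg (sub_nonneg.2 hB') (by positivity : (0 : ℝ) ≤ B)]
  rw [Real.log_pow]
  have e : N * Real.log (1 - 1 / (B : ℝ)) + N / B = N * (Real.log (1 - 1 / (B : ℝ)) + 1 / B) := by
    ring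
  have b1 : (Real.log (1 - 1 / (B : ℝ)) + 1 / B) ^ 2 ≤ (5 / 4 / (B : ℝ) ^ 2) ^ 2 :=
    sq_le_sq' (by linarith) (by linarith [show (0 : ℝ) ≤ 5 / 4 / (B : ℝ) ^ 2 by positivity])
  have b2 : 4 / (B : ℝ) * (((N : ℝ) / B) ^ 2 / (2 * B)) = N ^ 2 * (2 / (B : ℝ) ^ 4) := by
    field_simp; ring
  refine le_trans ?_ (mul_le_mul_of_nonneg_left hlow (by positivity))
  rw [e, mul_pow, b2]
  refine mul_le_mul_of_nonneg_left (b1.trans ?_) (by positivity)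
  rw [div_pow, ← pow_mul]
  exact div_le_div_of_nonneg_right (by norm_num) (by positivity)

/-- The gap between `0.499` and `1 / 2` pays for replacing `B` by `B - 1`. A mean of at least `√B`
is what makes the Chernoff bound effective. -/
lemma sqrt_le_mul_pow {B : ℕ} (hB : 1000 ≤ B) {N : ℕ}
    (hN : (N : ℝ) ≤ 0.499 * B * Real.log B) :
    √(B : ℝ) ≤ B * (1 - 1 / (B : ℝ)) ^ N := by
  have hB' : (1000 : ℝ) ≤ B := by exact_mod_cast hB
  have hB0 : (0 : ℝ) < B := by linarith
  have hp := pow_pos_of_two_le (by omega : 2 ≤ B) N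
  have hlog : 0 ≤ Real.log B := Real.log_nonneg (by linarith)
  have h1 : (N : ℝ) / (B - 1) ≤ Real.log B / 2 := by
    rw [div_le_iff₀ (by linarith)]
    nlinarith [mul_nonneg hlog (sub_nonneg.2 hB')]
  have h2 := (inv_pow_le_exp (by omega : 2 ≤ B) N).trans (Real.exp_le_exp.2 h1)
  have h3 : Real.exp (Real.log B / 2) = √(B : ℝ) := by
    rw [Real.exp_half, Real.exp_log hB0]
  rw [h3, inv_le_iff_one_le_mul₀ hp] at h2
  nlinarith [mul_le_mul_of_nonneg_left h2 (Real.sqrt_nonneg (B : ℝ)),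
    Real.mul_self_sqrt hB0.le]

lemma sq_log_le {w δ : ℝ} (hδ : δ < 1) (hδ0 : 0 < δ) (hw : 1 - δ ≤ w) :
    Real.log w ^ 2 ≤ (w - 1) ^ 2 / (1 - δ) ^ 2 := by
  have hd : 0 < 1 - δ := by linarith
  have hw0 : 0 < w := by linarith
  have h1 := Real.log_le_sub_one_of_pos hw0
  have h2 := Real.one_sub_inv_le_log_of_pos hw0
  rw [← div_pow, sq_le_sq, abs_div, abs_of_pos hd, le_div_iff₀ hd]
  rcases le_total 1 w with h | h
  · have h3 := Real.log_nonneg h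
    rw [abs_of_nonneg h3, abs_of_nonneg (by linarith)]
    nlinarith
  · have h3 := Real.log_nonpos hw0.le h
    rw [abs_of_nonpos h3, abs_of_nonpos (by linarith)]
    have h4 : -Real.log w * w ≤ 1 - w := by
      have := mul_le_mul_of_nonneg_right h2 hw0.le
      rw [sub_mul, inv_mul_cancel₀ hw0.ne'] at this
      linarith
    nlinarith

/-- For `z ≥ (1 - δ) * (B * p)`, linearize the logarithm and separate the bias by a weighted Young
inequality. Otherwise the error is at most `log B` and the exponential is at least `1`. -/
lemma sq_error_le {B p δ η lam L z : ℝ} (hB : 1 ≤ B) (hp : 0 < p) (hδ0 : 0 < δ) (hδ : δ < 1)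
    (hη : 0 < η) (hlam : 0 ≤ lam) (hlamB : lam ≤ Real.log B)
    (hL : 0 < z → L = Real.log (z / B)) (hL0 : -Real.log B ≤ L) (hL1 : L ≤ 0) :
    (L + lam) ^ 2 ≤ (1 + η) / (1 - δ) ^ 2 * (z / (B * p) - 1) ^ 2
      + (1 + η⁻¹) * (Real.log p + lam) ^ 2
      + Real.log B ^ 2 * Real.exp (δ * ((1 - δ) * (B * p) - z)) := by
  have hB0 : 0 < B := by linarith
  have hBp : 0 < B * p := mul_pos hB0 hp
  rcases le_or_gt ((1 - δ) * (B * p)) z with h | h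
  · have hz : 0 < z := lt_of_lt_of_le (mul_pos (by linarith) hBp) h
    have h1 : L = Real.log (z / (B * p)) + Real.log p := by
      rw [hL hz, ← Real.log_mul (by positivity) hp.ne']
      congr 1; field_simp
    have h2 := sq_log_le hδ hδ0 ((le_div_iff₀ hBp).2 h)
    set a := Real.log (z / (B * p))
    set c := Real.log p + lam
    have h3 : (a + c) ^ 2 ≤ (1 + η) * a ^ 2 + (1 + η⁻¹) * c ^ 2 := by
      have : (1 + η) * a ^ 2 + (1 + η⁻¹) * c ^ 2 - (a + c) ^ 2 = (η * a - c) ^ 2 * η⁻¹ := by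
        field_simp; ring
      have := mul_nonneg (sq_nonneg (η * a - c)) (inv_nonneg.2 hη.le)
      linarith
    have h4 := mul_le_mul_of_nonneg_left h2 (by linarith : 0 ≤ 1 + η)
    have h5 : 0 ≤ Real.log B ^ 2 * Real.exp (δ * ((1 - δ) * (B * p) - z)) := by positivity
    have h6 : L + lam = a + c := by rw [h1]; ring
    rw [h6, div_mul_eq_mul_div, ← mul_div_assoc] at *
    linarith
  · have h1 : 1 ≤ Real.exp (δ * ((1 - δ) * (B * p) - z)) :=
      Real.one_le_exp (mul_nonneg hδ0.le (by linarith))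
    have h2 : (L + lam) ^ 2 ≤ Real.log B ^ 2 := sq_le_sq' (by linarith) (by linarith)
    have h3 := le_mul_of_one_le_right (sq_nonneg (Real.log B)) h1
    have h4 : 0 ≤ (1 + η) / (1 - δ) ^ 2 * (z / (B * p) - 1) ^ 2 := by positivity
    have h5 : 0 ≤ (1 + η⁻¹) * (Real.log p + lam) ^ 2 := by positivity
    linarith

open Filter Topology in
lemma tendsto_errorRate : Tendsto errorRate atTop (𝓝 0) := by
  have hinv : ∀ k : ℕ, k ≠ 0 → Tendsto (fun y : ℝ => (y ^ k)⁻¹) atTop (𝓝 0) := fun k hk =>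
    tendsto_inv_atTop_zero.comp (tendsto_pow_atTop hk)
  have h1 : Tendsto (fun y : ℝ => (1 + (y ^ 4)⁻¹) / (1 - y⁻¹) ^ 2 * (1 + 2 * (y ^ 8)⁻¹)) atTop
      (𝓝 ((1 + 0) / (1 - 0) ^ 2 * (1 + 2 * 0))) :=
    (((hinv 4 (by norm_num)).const_add 1).div ((tendsto_inv_atTop_zero.const_sub 1).pow 2)
      (by norm_num)).mul (((hinv 8 (by norm_num)).const_mul 2).const_add 1)
  have h2 : Tendsto (fun y : ℝ => 4 * (y ^ 8)⁻¹ + 4 * (y ^ 4)⁻¹) atTop (𝓝 (4 * 0 + 4 * 0)) :=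
    ((hinv 8 (by norm_num)).const_mul 4).add ((hinv 4 (by norm_num)).const_mul 4)
  have h3 : Tendsto (fun y : ℝ => (1 + y ^ 4) * (4 * (y ^ 8)⁻¹)) atTop (𝓝 (4 * 0 + 4 * 0)) := by
    refine h2.congr' ?_
    filter_upwards [eventually_gt_atTop 0] with y hy
    field_simp
  have hsq : Tendsto (fun y : ℝ => y ^ 2 / 2) atTop atTop :=
    (tendsto_pow_atTop (by norm_num)).atTop_div_const (by norm_num)
  have h4 : Tendsto (fun y : ℝ => 2 * y ^ 40 * Real.exp (-(y ^ 2 / 2))) atTop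
      (𝓝 (2 ^ 21 * 0)) := by
    -- `2 * y ^ 40 = 2 ^ 21 * (y ^ 2 / 2) ^ 20`.
    refine (((Real.tendsto_pow_mul_exp_neg_atTop_nhds_zero 20).comp hsq).const_mul
      (2 ^ 21)).congr fun y => ?_
    simp only [Function.comp_def]
    ring
  have := ((h1.add h3).add h4).sub_const 1
  rw [show errorRate = _ from funext fun y => errorRate.eq_1 y]
  simpa using this

/-- Since `1 - exp (-δ) ≥ δ - δ ^ 2 / 2`, the exponent is at most `B * p * (δ - δ ^ 2 - δ + δ ^ 2 /
2)`. -/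
lemma chernoff_factor_le {B : ℕ} (hB : 2 ≤ B) (N : ℕ) {δ : ℝ} (hδ : 0 ≤ δ) :
    Real.exp (δ * ((1 - δ) * (B * (1 - 1 / (B : ℝ)) ^ N)))
      * (1 - (1 - 1 / (B : ℝ)) ^ N * (1 - Real.exp (-δ))) ^ B
      ≤ Real.exp (-(B * (1 - 1 / (B : ℝ)) ^ N * δ ^ 2 / 2)) := by
  have hB' : (2 : ℝ) ≤ B := by exact_mod_cast hB
  have hp := pow_pos_of_two_le hB N
  have hp1 : (1 - 1 / (B : ℝ)) ^ N ≤ 1 := by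
    refine pow_le_one₀ (by simpa using (pow_pos_of_two_le hB 1).le) ?_
    linarith [show (0 : ℝ) ≤ 1 / B by positivity]
  set p := (1 - 1 / (B : ℝ)) ^ N
  have hx := exp_neg_le_quadratic hδ
  have hx1 : Real.exp (-δ) ≤ 1 := Real.exp_le_one_iff.2 (by linarith)
  have hx0 := Real.exp_pos (-δ)
  have h1 : 1 - p * (1 - Real.exp (-δ)) ≤ Real.exp (-(p * (1 - Real.exp (-δ)))) := by
    linarith [Real.add_one_le_exp (-(p * (1 - Real.exp (-δ))))]
  have h2 := pow_le_pow_left₀ (by nlinarith) h1 B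
  rw [← Real.exp_nat_mul] at h2
  refine (mul_le_mul_of_nonneg_left h2 (Real.exp_pos _).le).trans ?_
  rw [← Real.exp_add, Real.exp_le_exp]
  have h3 := mul_le_mul_of_nonneg_left hx (by positivity : (0 : ℝ) ≤ B * p)
  nlinarith

/-! ### The mean square error -/

/-- The mean squared relative error of the logarithm of the fraction of empty bins. -/
theorem integral_sq_log_emptyCount_le {Ω α : Type*} [MeasurableSpace Ω] {μ : Measure Ω}
    [IsProbabilityMeasure μ] {B : ℕ} (hB : 1000 ≤ B) {g : α → Ω → Fin B}
    (hg : ∀ a, Measurable (g a)) (hu : ∀ a j, μ.real {ω | g a ω = j} = 1 / (B : ℝ))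
    (hi : iIndepFun g μ) (P : Finset α) (hP : 0 < P.card)
    (hN : (P.card : ℝ) ≤ 0.499 * B * Real.log B) {L : ℕ → ℝ}
    (hL : ∀ z, 0 < z → L z = Real.log ((z : ℝ) / B))
    (hL0 : -Real.log B ≤ L 0) (hL1 : L 0 ≤ 0) :
    ∫ ω, (L (emptyCount (fun a => g a ω) P) + (P.card : ℝ) / B) ^ 2 ∂μ
      ≤ (1 + errorRate ((B : ℝ) ^ (1 / 8 : ℝ))) * leading B P.card := by
  have hB' : (1000 : ℝ) ≤ B := by exact_mod_cast hB
  have hB0 : (0 : ℝ) < B := by linarith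
  set N := P.card with hNdef
  -- Take `δ = y⁻¹` and `η = (y ^ 4)⁻¹`. Both vanish as `B` grows, yet `B * p * δ ^ 2 ≥ y ^ 2`
  -- diverges and the bias factor `(1 + η⁻¹) * 4 / B` tends to `0`.
  set y : ℝ := (B : ℝ) ^ (1 / 8 : ℝ) with hy
  have hy8 : y ^ 8 = B := by
    rw [hy, ← Real.rpow_natCast, ← Real.rpow_mul hB0.le]; norm_num
  have hy1 : 1 < y := Real.one_lt_rpow (by linarith) (by norm_num)
  have hy0 : 0 < y := by linarith
  have hδ1 : y⁻¹ < 1 := inv_lt_one_of_one_lt₀ hy1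
  have hp := pow_pos_of_two_le (by omega : 2 ≤ B) N
  have hsqrt := sqrt_le_mul_pow hB hN
  have hvar := relative_variance_le (by omega : 10 ≤ B) N
  have hbias := sq_log_pow_add_le (by omega : 10 ≤ B) N
  have hlow := sq_div_le_leading (by omega : 2 ≤ B) N
  have hchern := chernoff_factor_le (by omega : 2 ≤ B) N (inv_nonneg.2 hy0.le)
  set p := (1 - 1 / (B : ℝ)) ^ N with hpdef
  have hBp : 0 < B * p := mul_pos hB0 hp
  have hlogB : 0 ≤ Real.log B := Real.log_nonneg (by linarith)
  let Z : Ω → ℕ := fun ω => emptyCount (fun a => g a ω) P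
  have hint : ∀ f : ℕ → ℝ, Integrable (fun ω => f (Z ω)) μ := fun f =>
    integrable_comp_emptyCount hg P f
  have hE : ∀ f : ℕ → ℝ, ∫ ω, f (Z ω) ∂μ = (step B)^[N] f B := fun f =>
    integral_comp_emptyCount (by omega) hg hu hi P f
  have hmean : ∫ ω, (Z ω : ℝ) ∂μ = p * B := by
    rw [hE fun z => (z : ℝ), step_iterate_natCast]
  have hfact : ∫ ω, (Z ω : ℝ) * (Z ω - 1) ∂μ = (1 - 2 / (B : ℝ)) ^ N * (B * (B - 1)) := by
    rw [hE fun z => (z : ℝ) * (z - 1), step_iterate_mul_pred]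
  have hgen : ∫ ω, Real.exp (-y⁻¹) ^ Z ω ∂μ ≤ (1 - p * (1 - Real.exp (-y⁻¹))) ^ B := by
    rw [hE fun z => Real.exp (-y⁻¹) ^ z]
    exact step_iterate_pow_le (by omega) (Real.exp_pos _)
      (Real.exp_le_one_iff.2 (by linarith [inv_pos.2 hy0])) N B le_rfl
  have hV : ∫ ω, ((Z ω : ℝ) / (B * p) - 1) ^ 2 ∂μ ≤ (1 + 2 / (B : ℝ)) * leading B N := by
    refine le_trans (le_of_eq ?_) hvar
    have e : ∀ ω, ((Z ω : ℝ) / (B * p) - 1) ^ 2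
        = 1 / (B * p) ^ 2 * ((Z ω : ℝ) * (Z ω - 1))
          + (1 / (B * p) ^ 2 - 2 / (B * p)) * (Z ω : ℝ) + 1 := fun ω => by
      field_simp; ring
    simp_rw [e]
    rw [integral_add (hint fun z => 1 / (B * p) ^ 2 * ((z : ℝ) * (z - 1))
          + (1 / (B * p) ^ 2 - 2 / (B * p)) * (z : ℝ)) (integrable_const _),
      integral_add ((hint fun z => (z : ℝ) * (z - 1)).const_mul _)
        ((hint fun z => (z : ℝ)).const_mul _),
      integral_const_mul, integral_const_mul, hmean, hfact]
    simp only [integral_const, probReal_univ, smul_eq_mul, mul_one]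
    field_simp
    ring
  have hT : ∫ ω, Real.exp (y⁻¹ * ((1 - y⁻¹) * (B * p) - Z ω)) ∂μ ≤ Real.exp (-(y ^ 2 / 2)) := by
    have e : ∀ ω, Real.exp (y⁻¹ * ((1 - y⁻¹) * (B * p) - Z ω))
        = Real.exp (y⁻¹ * ((1 - y⁻¹) * (B * p))) * Real.exp (-y⁻¹) ^ Z ω := fun ω => by
      rw [← Real.exp_nat_mul, ← Real.exp_add]; congr 1; ring
    simp_rw [e]
    rw [integral_const_mul]
    refine (mul_le_mul_of_nonneg_left hgen (Real.exp_pos _).le).trans (hchern.trans ?_)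
    rw [Real.exp_le_exp, neg_le_neg_iff]
    have hs : √(B : ℝ) = y ^ 4 := by
      rw [← hy8, show y ^ 8 = (y ^ 4) ^ 2 by ring, Real.sqrt_sq (by positivity)]
    rw [hs] at hsqrt
    have : y ^ 2 / 2 = y ^ 4 * y⁻¹ ^ 2 / 2 := by field_simp
    rw [this]
    gcongr
  have hlam : (N : ℝ) / B ≤ Real.log B := by
    rw [div_le_iff₀ hB0]; nlinarith
  have hpt : ∀ ω, (L (Z ω) + (N : ℝ) / B) ^ 2
      ≤ (1 + (y ^ 4)⁻¹) / (1 - y⁻¹) ^ 2 * ((Z ω : ℝ) / (B * p) - 1) ^ 2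
        + (1 + y ^ 4) * (Real.log p + N / B) ^ 2
        + Real.log B ^ 2 * Real.exp (y⁻¹ * ((1 - y⁻¹) * (B * p) - Z ω)) := fun ω => by
    have hzB : (Z ω : ℝ) ≤ B := by exact_mod_cast emptyCount_le (fun a => g a ω) P
    have hLr : -Real.log B ≤ L (Z ω) ∧ L (Z ω) ≤ 0 := by
      rcases Nat.eq_zero_or_pos (Z ω) with h | h
      · rw [h]; exact ⟨hL0, hL1⟩
      · have h' : (1 : ℝ) ≤ Z ω := by exact_mod_cast h
        rw [hL _ h]
        refine ⟨?_, Real.log_nonpos (by positivity) ((div_le_one hB0).2 hzB)⟩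
        rw [Real.log_div (by linarith) hB0.ne']
        linarith [Real.log_nonneg h']
    have := sq_error_le (z := Z ω) (by linarith : (1 : ℝ) ≤ B) hp (inv_pos.2 hy0) hδ1
      (inv_pos.2 (pow_pos hy0 4)) (by positivity : (0 : ℝ) ≤ N / B) hlam
      (fun h => hL _ (by exact_mod_cast h)) hLr.1 hLr.2
    rwa [inv_inv] at this
  have hI : ∫ ω, (L (Z ω) + (N : ℝ) / B) ^ 2 ∂μ
      ≤ (1 + (y ^ 4)⁻¹) / (1 - y⁻¹) ^ 2 * ∫ ω, ((Z ω : ℝ) / (B * p) - 1) ^ 2 ∂μ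
        + (1 + y ^ 4) * (Real.log p + N / B) ^ 2
        + Real.log B ^ 2 * ∫ ω, Real.exp (y⁻¹ * ((1 - y⁻¹) * (B * p) - Z ω)) ∂μ := by
    have i1 := (hint fun z => ((z : ℝ) / (B * p) - 1) ^ 2).const_mul
      ((1 + (y ^ 4)⁻¹) / (1 - y⁻¹) ^ 2)
    have i2 : Integrable (fun _ : Ω => (1 + y ^ 4) * (Real.log p + N / B) ^ 2) μ :=
      integrable_const _
    have i3 := (hint fun z => Real.exp (y⁻¹ * ((1 - y⁻¹) * (B * p) - z))).const_mul
      (Real.log B ^ 2)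
    refine (integral_mono (hint fun z => (L z + (N : ℝ) / B) ^ 2) ((i1.add i2).add i3)
      hpt).trans (le_of_eq ?_)
    rw [integral_add' (i1.add i2) i3, integral_add' i1 i2, integral_const_mul, integral_const_mul,
      integral_const_mul]
    simp
  have hA : 0 ≤ (1 + (y ^ 4)⁻¹) / (1 - y⁻¹) ^ 2 := by positivity
  have t1 := mul_le_mul_of_nonneg_left hV hA
  have t2 := mul_le_mul_of_nonneg_left hbias (by positivity : 0 ≤ 1 + y ^ 4)
  have t3 : Real.log B ^ 2 * ∫ ω, Real.exp (y⁻¹ * ((1 - y⁻¹) * (B * p) - Z ω)) ∂μ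
      ≤ 2 * y ^ 40 * Real.exp (-(y ^ 2 / 2)) * leading B N := by
    have h1 : Real.log B ≤ B := by linarith [Real.log_le_sub_one_of_pos hB0]
    have h2 : Real.log B ^ 2 ≤ (B : ℝ) ^ 2 := pow_le_pow_left₀ hlogB h1 2
    -- With at least one ball, `leading` is only polynomially small, so the exponential tail is
    -- negligible beside it.
    have h3 : 1 / (2 * (B : ℝ) ^ 3) ≤ leading B N := by
      refine le_trans ?_ hlow
      have hN1 : (1 : ℝ) ≤ N := by exact_mod_cast hP
      have : ((N : ℝ) / B) ^ 2 / (2 * B) = N ^ 2 / (2 * (B : ℝ) ^ 3) := by field_simp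
      rw [this]
      exact div_le_div_of_nonneg_right (by nlinarith) (by positivity)
    have h4 : (B : ℝ) ^ 2 = 2 * y ^ 40 * (1 / (2 * (B : ℝ) ^ 3)) := by
      rw [← hy8]; field_simp
    have h5 : Real.log B ^ 2 ≤ 2 * y ^ 40 * leading B N :=
      h2.trans (h4.le.trans (mul_le_mul_of_nonneg_left h3 (by positivity)))
    calc _ ≤ Real.log B ^ 2 * Real.exp (-(y ^ 2 / 2)) :=
          mul_le_mul_of_nonneg_left hT (sq_nonneg _)
      _ ≤ 2 * y ^ 40 * leading B N * Real.exp (-(y ^ 2 / 2)) :=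
          mul_le_mul_of_nonneg_right h5 (Real.exp_pos _).le
      _ = _ := by ring
  refine hI.trans ((add_le_add (add_le_add t1 t2) t3).trans (le_of_eq ?_))
  rw [errorRate, hy8]
  ring

/-! ### Transfer to the estimators -/

lemma mseBound_eq {B b : ℕ} (hB : 0 < B) (hb : 0 < b) (n : ℕ) :
    mseBound B b n = ((B : ℝ) / b) ^ 2 * leading B (b * n) := by
  have hB' : (0 : ℝ) < B := by exact_mod_cast hB
  have hb' : (0 : ℝ) < b := by exact_mod_cast hb
  rw [mseBound, leading]
  push_cast
  rw [mul_comm (n : ℝ) b]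
  field_simp

/-- The bounds for the estimator of the size of a single set. -/
theorem estimator_bounds {Ω U : Type*} [MeasurableSpace Ω] {μ : Measure Ω}
    [IsProbabilityMeasure μ] {B b : ℕ} (hB : 1000 ≤ B) (hb : 0 < b)
    {h : Ω → Fin b → U → Fin B} (hh : IsPerfectlyRandom μ h) {s : ℝ} (hs0 : 0 ≤ s)
    (hs : s ≤ (B : ℝ) / b * Real.log B) (X : Finset U)
    (hX : (b : ℝ) * X.card ≤ 0.499 * B * Real.log B) :
    Integrable (fun ω => (estimator s (h ω) X - X.card) ^ 2) μ ∧
    ∫ ω, (estimator s (h ω) X - X.card) ^ 2 ∂μ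
      ≤ (1 + errorRate ((B : ℝ) ^ (1 / 8 : ℝ))) * mseBound B b X.card ∧
    ∀ t : ℝ, 0 < t → μ.real {ω | t ≤ |estimator s (h ω) X - X.card|}
      ≤ (1 + errorRate ((B : ℝ) ^ (1 / 8 : ℝ))) * (mseBound B b X.card / t ^ 2) := by
  have hB0 : (0 : ℝ) < B := by exact_mod_cast (by omega : 0 < B)
  have hb0 : (0 : ℝ) < b := by exact_mod_cast hb
  let g : Fin b × U → Ω → Fin B := fun p ω => h ω p.1 p.2
  have hg : ∀ p, Measurable (g p) := fun p => hh.measurable p.1 p.2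
  let P : Finset (Fin b × U) := Finset.univ ×ˢ X
  have hcard : P.card = b * X.card := by simp [P]
  -- The value at `0` encodes `s`; the range of `s` places it in `[-log B, 0]`.
  let L : ℕ → ℝ := fun z => if z = 0 then -(b / B * s) else Real.log ((z : ℝ) / B)
  have hest : ∀ ω, (estimator s (h ω) X - X.card) ^ 2
      = ((B : ℝ) / b) ^ 2 * (L (emptyCount (fun a => g a ω) P) + (P.card : ℝ) / B) ^ 2 := by
    intro ω
    have hle := emptyCount_le (fun a => g a ω) P
    have hones : ones (bits (h ω) X) = B - emptyCount (fun a => g a ω) P := ones_bits (h ω) X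
    rw [estimator, hones, swamidass, hcard, ← mul_pow]
    by_cases hz : emptyCount (fun a => g a ω) P = 0
    · simp only [L, hz, if_true, Nat.sub_zero]
      push_cast
      rw [← neg_sq]
      congr 1
      field_simp
      ring
    · rw [if_neg (by omega), Nat.cast_sub hle]
      simp only [L, hz, if_false]
      rw [show 1 - ((B : ℝ) - (emptyCount (fun a => g a ω) P : ℝ)) / B
        = (emptyCount (fun a => g a ω) P : ℝ) / B by field_simp; ring]
      push_cast
      rw [← neg_sq]
      congr 1
      field_simp
      ring
  have hint : Integrable (fun ω => (estimator s (h ω) X - X.card) ^ 2) μ := by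
    simp_rw [hest]
    exact (integrable_comp_emptyCount hg P fun z => (L z + (P.card : ℝ) / B) ^ 2).const_mul _
  have hmse : ∫ ω, (estimator s (h ω) X - X.card) ^ 2 ∂μ
      ≤ (1 + errorRate ((B : ℝ) ^ (1 / 8 : ℝ))) * mseBound B b X.card := by
    -- For the empty set both sides vanish; the integral bound needs a ball.
    rcases Nat.eq_zero_or_pos X.card with h0 | h0
    · have hX0 : X = ∅ := Finset.card_eq_zero.1 h0
      have hBne : B ≠ 0 := by omega
      have : ∀ ω, (estimator s (h ω) X - X.card) ^ 2 = 0 := fun ω => by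
        rw [hest]
        simp [P, hX0, L, emptyCount, hBne]
      simp_rw [this]
      simp [mseBound, h0]
    · simp_rw [hest]
      rw [integral_const_mul, mseBound_eq (by omega) hb, ← hcard, mul_left_comm]
      refine mul_le_mul_of_nonneg_left ?_ (sq_nonneg _)
      refine integral_sq_log_emptyCount_le hB hg (fun a j => hh.uniform a.1 a.2 j) hh.indep P
        (by rw [hcard]; positivity) (by rw [hcard]; exact_mod_cast hX)
        (fun z hz => if_neg hz.ne') ?_ ?_
      · simp only [L, if_true, neg_le_neg_iff]
        rw [div_mul_eq_mul_div, div_le_iff₀ hB0]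
        rw [div_mul_eq_mul_div, le_div_iff₀ hb0] at hs
        linarith
      · simp only [L, if_true, neg_nonpos]
        positivity
  refine ⟨hint, hmse, fun t ht => ?_⟩
  have hset : {ω | t ≤ |estimator s (h ω) X - X.card|}
      = {ω | t ^ 2 ≤ (estimator s (h ω) X - X.card) ^ 2} := by
    ext ω
    change t ≤ |estimator s (h ω) X - X.card| ↔ t ^ 2 ≤ (estimator s (h ω) X - X.card) ^ 2
    rw [← sq_abs (estimator s (h ω) X - X.card),
      pow_le_pow_iff_left₀ ht.le (abs_nonneg _) two_ne_zero]
  have hmarkov := mul_meas_ge_le_integral_of_nonneg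
    (Filter.Eventually.of_forall fun ω => sq_nonneg (estimator s (h ω) X - X.card)) hint (t ^ 2)
  rw [hset, ← mul_div_assoc, le_div_iff₀ (by positivity), mul_comm]
  exact hmarkov.trans hmse

end BloomFilter

open BloomFilter MeasureTheory Filter Asymptotics Topology in
theorem mainTheorem4 {ι : Type*} (l : Filter ι) (B b : ι → ℕ)
    (hB : Tendsto B l atTop) (hb : ∀ i, 0 < b i)
    (hbB : (fun i => (b i : ℝ)) =o[l] fun i => √(B i : ℝ)) :
    ∃ ε : ι → ℝ, Tendsto ε l (𝓝 0) ∧ ∀ᶠ i in l,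
      ∀ (Ω : Type*) [MeasurableSpace Ω] (μ : Measure Ω) [IsProbabilityMeasure μ]
        (U : Type*) [DecidableEq U] (h : Ω → Fin (b i) → U → Fin (B i)),
        IsPerfectlyRandom μ h →
        ∀ s : ℝ, 0 ≤ s → s ≤ (B i : ℝ) / b i * Real.log (B i) →
          -- intersections of two sets
          (∀ X Y : Finset U,
            (b i : ℝ) * (X ∩ Y).card ≤ 0.499 * B i * Real.log (B i) →
            Integrable (fun ω => (estimatorAND s (h ω) X Y - (X ∩ Y).card) ^ 2) μ ∧
            ∫ ω, (estimatorAND s (h ω) X Y - (X ∩ Y).card) ^ 2 ∂μ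
              ≤ (1 + ε i) * mseBound (B i) (b i) (X ∩ Y).card ∧
            ∀ t : ℝ, 0 < t →
              μ.real {ω | t ≤ |estimatorAND s (h ω) X Y - (X ∩ Y).card|}
                ≤ (1 + ε i) * (mseBound (B i) (b i) (X ∩ Y).card / t ^ 2)) ∧
          -- single sets
          (∀ X : Finset U,
            (b i : ℝ) * X.card ≤ 0.499 * B i * Real.log (B i) →
            Integrable (fun ω => (estimator s (h ω) X - X.card) ^ 2) μ ∧
            ∫ ω, (estimator s (h ω) X - X.card) ^ 2 ∂μ
              ≤ (1 + ε i) * mseBound (B i) (b i) X.card ∧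
            ∀ t : ℝ, 0 < t →
              μ.real {ω | t ≤ |estimator s (h ω) X - X.card|}
                ≤ (1 + ε i) * (mseBound (B i) (b i) X.card / t ^ 2)) := by
  have hBr : Tendsto (fun i => (B i : ℝ) ^ (1 / 8 : ℝ)) l atTop :=
    (tendsto_rpow_atTop (by norm_num)).comp (tendsto_natCast_atTop_atTop.comp hB)
  refine ⟨fun i => errorRate ((B i : ℝ) ^ (1 / 8 : ℝ)), tendsto_errorRate.comp hBr, ?_⟩
  filter_upwards [hB.eventually_ge_atTop 1000] with i hBi
  intro Ω _ μ _ U _ h hh s hs0 hs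
  exact ⟨fun X Y hXY => estimator_bounds hBi (hb i) hh hs0 hs (X ∩ Y) hXY,
    fun X hX => estimator_bounds hBi (hb i) hh hs0 hs X hX⟩
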